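/- Let $|LLT\rangle = |0\rangle(|01\rangle+|22\rangle)+|1\rangle(|00\rangle+|12\rangle)\in\mathbb{C}^2\otimes\mathbb{C}^3\otimes\mathbb{C}^3$, let $b=(b_{rs})_{r,s=0}^{2}$ be a complex $3\times 3$ matrix with $b_{20}=0$, and write $(\mathbb{1}\otimes b\otimes\mathbb{1})|LLT\rangle=\sum_{i,\alpha,\beta}A^i_{\alpha\beta}|i\rangle|\alpha\rangle|\beta\rangle$ with $3\times3$ matrices $A^0,A^1$. For $N\ge 1$ let $$|\Psi\rangle=\sum_{j\in\{0,1\}^N}\mathrm{tr}\left(A^{j_1}A^{j_2}\cdots A^{j_N}\right)|j_1\ldots j_N\rangle$$ be the $N$-qubit matrix product state generated by it. Then: 1. For every $j\in\{0,1\}^N$ with Hamming weight $|j|$ (the number of ones), $$\mathrm{tr}\left(A^{j_1}A^{j_2}\cdots A^{j_N}\right)=b_{22}^{\,N-|j|}\,b_{21}^{\,|j|}+b_{00}^{\,|j|}\,b_{10}^{\,N-|j|}.$$ 2. $|\Psi\rangle$ is invariant under all permutations of the $N$ qubits. 3. If $|\Psi\rangle\neq 0$, then $|\Psi\rangle$ is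 SLOCC-equivalent to $|0\rangle^{\otimes N}$, or SLOCC-equivalent to $|\mathrm{GHZ}_N\rangle=\frac{1}{\sqrt2}(|0\rangle^{\otimes N}+|1\rangle^{\otimes N})$, or else all its local symmetries are global. Here two $N$-qubit vectors $\psi,\phi$ are SLOCC-equivalent if $\phi=(g_1\otimes\cdots\otimes g_N)\psi$ for some $g_1,\ldots,g_N\in GL(2,\mathbb{C})$; a local symmetry of $\psi$ is an operator $S=g_1\otimes\cdots\otimes g_N$ with all $g_k\in GL(2,\mathbb{C})$ and $S\psi=\psi$; and it is global if $S=g^{\otimes N}$ for some $g\in GL(2,\mathbb{C})$. -/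

import Mathlib

open Matrix
open scoped Kronecker

noncomputable section

namespace QubitMPS

/-- Tripartite states in `ℂ² ⊗ ℂ³ ⊗ ℂ³`, by their coordinates `(i, α, β)` in the standard basis. -/
abbrev FiducialState : Type := Fin 2 × Fin 3 × Fin 3 → ℂ

/-- The basis vector `|i⟩ ⊗ |α⟩ ⊗ |β⟩`. -/
def ket (i : Fin 2) (α β : Fin 3) : FiducialState := Pi.single (i, α, β) 1

/-- `|LLT⟩ = |0⟩(|01⟩ + |22⟩) + |1⟩(|00⟩ + |12⟩)`. -/
def LLT : FiducialState := ket 0 0 1 + ket 0 2 2 + (ket 1 0 0 + ket 1 1 2)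

/-- The fiducial state `(1 ⊗ b ⊗ 1)|LLT⟩`. -/
def fiducial (b : Matrix (Fin 3) (Fin 3) ℂ) : FiducialState :=
  ((1 : Matrix (Fin 2) (Fin 2) ℂ) ⊗ₖ (b ⊗ₖ (1 : Matrix (Fin 3) (Fin 3) ℂ))) *ᵥ LLT

/-- The matrices `A⁰, A¹` of a fiducial state `∑ A^i_{αβ} |i⟩|α⟩|β⟩`. -/
def tensor (A : FiducialState) (i : Fin 2) : Matrix (Fin 3) (Fin 3) ℂ :=
  Matrix.of fun α β => A (i, α, β)

/-- Vectors in `(ℂ²)^{⊗N}`, by their coordinates in the computational basis. -/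
abbrev NQubit (N : ℕ) : Type := (Fin N → Fin 2) → ℂ

/-- The ordered product `A^{j₁} A^{j₂} ⋯ A^{j_N}`. -/
def tensorProd (A : FiducialState) {N : ℕ} (j : Fin N → Fin 2) : Matrix (Fin 3) (Fin 3) ℂ :=
  (List.ofFn fun k => tensor A (j k)).prod

/-- The translationally invariant matrix product state
`∑_j tr(A^{j₁} ⋯ A^{j_N}) |j₁ … j_N⟩` generated by `A`. -/
def mps (A : FiducialState) (N : ℕ) : NQubit N := fun j => (tensorProd A j).trace

/-- The local operator `g₁ ⊗ ⋯ ⊗ g_N`, as a matrix in the computational basis. -/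
def localOp {N : ℕ} (g : Fin N → GL (Fin 2) ℂ) :
    Matrix (Fin N → Fin 2) (Fin N → Fin 2) ℂ :=
  Matrix.of fun i j => ∏ k, (g k : Matrix (Fin 2) (Fin 2) ℂ) (i k) (j k)

/-- SLOCC equivalence: `φ` is the image of `ψ` under an invertible local operator. -/
def SLOCCEquiv {N : ℕ} (ψ φ : NQubit N) : Prop :=
  ∃ g : Fin N → GL (Fin 2) ℂ, localOp g *ᵥ ψ = φ

/-- The local symmetries of `ψ`: the invertible local operators that fix `ψ`. -/
def localSymmetries {N : ℕ} (ψ : NQubit N) : Set (Matrix (Fin N → Fin 2) (Fin N → Fin 2) ℂ) :=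
  {S | (∃ g : Fin N → GL (Fin 2) ℂ, S = localOp g) ∧ S *ᵥ ψ = ψ}

/-- Every local symmetry of `ψ` is global, that is, of the form `g^{⊗N}`. -/
def OnlyGlobalSymmetries {N : ℕ} (ψ : NQubit N) : Prop :=
  ∀ S ∈ localSymmetries ψ, ∃ g : GL (Fin 2) ℂ, S = localOp fun _ : Fin N => g

/-- Invariance under every permutation of the `N` qubits. -/
def PermutationInvariant {N : ℕ} (ψ : NQubit N) : Prop :=
  ∀ (σ : Equiv.Perm (Fin N)) (j : Fin N → Fin 2), ψ (j ∘ σ) = ψ j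

/-- The product state `|0⟩^{⊗N}`. -/
def zeroState (N : ℕ) : NQubit N := Pi.single (fun _ => 0) 1

/-- The state `|GHZ_N⟩ = (|0…0⟩ + |1…1⟩)/√2`. -/
def ghzState (N : ℕ) : NQubit N :=
  ((Real.sqrt 2 : ℝ) : ℂ)⁻¹ • (Pi.single (fun _ => 0) 1 + Pi.single (fun _ => 1) 1)

end QubitMPS

end

namespace QubitMPS

/-! Both matrices `A^i` share the right eigenvector `b.col 0`, with eigenvalues `b 1 0`, `b 0 0`,
and the left eigenvector `e₂`, with eigenvalues `b 2 2`, `b 2 1`. By `trace_list_prod`, the trace of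
a nonempty product is the sum of the two products of eigenvalues, so the state is `x^{⊗N} + y^{⊗N}`
with `x = (b 2 2, b 2 1)` and `y = (b 1 0, b 0 0)` (`mps_fiducial`). The trace formula and the
permutation symmetry follow. If `x`, `y` are independent, one invertible map sends them to the
standard basis, giving GHZ; if parallel, the state is a multiple of some `z^{⊗N}`. The third
alternative never has to be invoked. -/

/-- The product state `v^{⊗N}`. -/
def tensorPower (N : ℕ) (v : Fin 2 → ℂ) : NQubit N := fun j => ∏ k, v (j k)

theorem tensorPower_smul (N : ℕ) (a : ℂ) (v : Fin 2 → ℂ) :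
    tensorPower N (a • v) = a ^ N • tensorPower N v := by
  ext j
  simp [tensorPower, Finset.prod_mul_distrib]

theorem tensorPower_single (N : ℕ) (i : Fin 2) :
    tensorPower N (Pi.single i 1) = Pi.single (fun _ => i) 1 := by
  ext j
  simp [tensorPower, Pi.single_apply, Finset.prod_ite_zero, funext_iff]

theorem tensorPower_apply (N : ℕ) (v : Fin 2 → ℂ) (j : Fin N → Fin 2) :
    tensorPower N v j = v 0 ^ (N - hammingNorm j) * v 1 ^ hammingNorm j := by
  have hv : ∀ k, v (j k) = if j k ≠ 0 then v 1 else v 0 := fun k => by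
    by_cases h : j k = 0
    · simp [h]
    · simp [Fin.eq_one_of_ne_zero _ h]
  have hc := Finset.card_filter_add_card_filter_not (s := Finset.univ) (fun k => j k ≠ 0)
  rw [Finset.card_univ, Fintype.card_fin] at hc
  simp only [tensorPower, hv, Finset.prod_ite, Finset.prod_const, hammingNorm]
  rw [mul_comm, ← Nat.eq_sub_of_add_eq' hc]

theorem tensorPower_comp_perm (N : ℕ) (v : Fin 2 → ℂ) (σ : Equiv.Perm (Fin N))
    (j : Fin N → Fin 2) : tensorPower N v (j ∘ σ) = tensorPower N v j :=
  Equiv.prod_comp σ fun k => v (j k)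

theorem localOp_mulVec_tensorPower {N : ℕ} (g : Fin N → GL (Fin 2) ℂ) (v : Fin 2 → ℂ)
    (i : Fin N → Fin 2) :
    (localOp g *ᵥ tensorPower N v) i =
      ∏ k, ((g k : Matrix (Fin 2) (Fin 2) ℂ) *ᵥ v) (i k) := by
  simp only [localOp, tensorPower, mulVec, dotProduct, Matrix.of_apply, ← Finset.prod_mul_distrib,
    Finset.prod_univ_sum, Fintype.piFinset_univ]

/-- A local operator acting as `s • g^{⊗N}`. -/
theorem exists_localOp_smul {N : ℕ} (hN : 1 ≤ N) (g : GL (Fin 2) ℂ) {s : ℂ} (hs : s ≠ 0) :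
    ∃ h : Fin N → GL (Fin 2) ℂ, ∀ v, localOp h *ᵥ tensorPower N v =
      s • tensorPower N ((g : Matrix (Fin 2) (Fin 2) ℂ) *ᵥ v) := by
  obtain ⟨n, rfl⟩ := Nat.exists_eq_add_of_le' hN
  -- The scalar is absorbed into the first factor, so no `N`-th root is needed.
  refine ⟨Fin.cons (Units.mk0 s hs • g) fun _ => g, fun v => ?_⟩
  ext i
  rw [localOp_mulVec_tensorPower, Fin.prod_univ_succ, Pi.smul_apply, tensorPower,
    Fin.prod_univ_succ, smul_eq_mul, ← mul_assoc]
  simp only [Fin.cons_zero, Fin.cons_succ]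
  congr 1
  exact congrFun (Matrix.smul_mulVec s (g : Matrix (Fin 2) (Fin 2) ℂ) v) (i 0)

theorem exists_mulVec_eq_single {x y : Fin 2 → ℂ} (h : x 0 * y 1 ≠ y 0 * x 1) :
    ∃ g : GL (Fin 2) ℂ, (g : Matrix (Fin 2) (Fin 2) ℂ) *ᵥ x = Pi.single 0 1 ∧
      (g : Matrix (Fin 2) (Fin 2) ℂ) *ᵥ y = Pi.single 1 1 := by
  have hdet : (!![x 0, y 0; x 1, y 1]).det ≠ 0 := by
    rw [Matrix.det_fin_two_of]
    exact sub_ne_zero.mpr h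
  have hx : x = !![x 0, y 0; x 1, y 1] *ᵥ Pi.single 0 1 := by
    ext i; fin_cases i <;> simp
  have hy : y = !![x 0, y 0; x 1, y 1] *ᵥ Pi.single 1 1 := by
    ext i; fin_cases i <;> simp
  set M := !![x 0, y 0; x 1, y 1]
  have hM : M⁻¹ * M = 1 := Matrix.nonsing_inv_mul M (isUnit_iff_ne_zero.mpr hdet)
  refine ⟨(Matrix.GeneralLinearGroup.mkOfDetNeZero M hdet)⁻¹, ?_, ?_⟩
  · rw [hx, Matrix.coe_units_inv]
    exact (Matrix.mulVec_mulVec _ _ _).trans (by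
      rw [show (Matrix.GeneralLinearGroup.mkOfDetNeZero M hdet : Matrix (Fin 2) (Fin 2) ℂ) = M
        from rfl, hM, Matrix.one_mulVec])
  · rw [hy, Matrix.coe_units_inv]
    exact (Matrix.mulVec_mulVec _ _ _).trans (by
      rw [show (Matrix.GeneralLinearGroup.mkOfDetNeZero M hdet : Matrix (Fin 2) (Fin 2) ℂ) = M
        from rfl, hM, Matrix.one_mulVec])

theorem exists_mulVec_eq_single_zero {z : Fin 2 → ℂ} (hz : z ≠ 0) :
    ∃ g : GL (Fin 2) ℂ, (g : Matrix (Fin 2) (Fin 2) ℂ) *ᵥ z = Pi.single 0 1 := by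
  by_cases h0 : z 0 = 0
  · have h1 : z 1 ≠ 0 := fun h1 => hz (by ext i; fin_cases i <;> simp [h0, h1])
    obtain ⟨g, hg, -⟩ := exists_mulVec_eq_single (x := z) (y := ![1, 0]) (by simpa using h1.symm)
    exact ⟨g, hg⟩
  · obtain ⟨g, hg, -⟩ := exists_mulVec_eq_single (x := z) (y := ![0, 1]) (by simpa using h0)
    exact ⟨g, hg⟩

/-- Two parallel vectors in the plane are multiples of a common nonzero vector. -/
theorem exists_common_direction {x y : Fin 2 → ℂ} (h : x 0 * y 1 = y 0 * x 1) :
    ∃ z : Fin 2 → ℂ, z ≠ 0 ∧ ∃ a c : ℂ, x = a • z ∧ y = c • z := by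
  by_cases hx : x = 0
  · by_cases hy : y = 0
    · exact ⟨![1, 0], fun h => one_ne_zero (congrFun h 0), 0, 0, by simp [hx], by simp [hy]⟩
    · exact ⟨y, hy, 0, 1, by simp [hx], by simp⟩
  · by_cases h0 : x 0 = 0
    · have h1 : x 1 ≠ 0 := fun h1 => hx (by ext i; fin_cases i <;> simp [h0, h1])
      have hy0 : y 0 = 0 := by simpa [h0, h1] using h
      exact ⟨x, hx, 1, y 1 / x 1, by simp, by ext i; fin_cases i <;> simp [h0, hy0, h1]⟩
    · refine ⟨x, hx, 1, y 0 / x 0, by simp, ?_⟩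
      ext i
      fin_cases i
      · simp [h0]
      · simp only [Fin.mk_one, Pi.smul_apply, smul_eq_mul]
        field_simp
        linear_combination h

theorem sloccEquiv_ghzState {N : ℕ} (hN : 1 ≤ N) {x y : Fin 2 → ℂ} (h : x 0 * y 1 ≠ y 0 * x 1) :
    SLOCCEquiv (tensorPower N x + tensorPower N y) (ghzState N) := by
  obtain ⟨g, hx, hy⟩ := exists_mulVec_eq_single h
  obtain ⟨k, hk⟩ := exists_localOp_smul hN g (s := ((Real.sqrt 2 : ℝ) : ℂ)⁻¹) (by simp)
  refine ⟨k, ?_⟩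
  rw [Matrix.mulVec_add, hk, hk, hx, hy, tensorPower_single, tensorPower_single, ← smul_add]
  rfl

theorem sloccEquiv_zeroState {N : ℕ} (hN : 1 ≤ N) {x y : Fin 2 → ℂ} (h : x 0 * y 1 = y 0 * x 1)
    (hne : tensorPower N x + tensorPower N y ≠ 0) :
    SLOCCEquiv (tensorPower N x + tensorPower N y) (zeroState N) := by
  obtain ⟨z, hz, a, c, rfl, rfl⟩ := exists_common_direction h
  rw [tensorPower_smul, tensorPower_smul, ← add_smul] at hne ⊢
  -- The state is `(a ^ N + c ^ N) • z^{⊗N}`, so its nonvanishing makes this scalar invertible.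
  have hs := (smul_ne_zero_iff.mp hne).1
  obtain ⟨g, hg⟩ := exists_mulVec_eq_single_zero hz
  obtain ⟨k, hk⟩ := exists_localOp_smul hN g (inv_ne_zero hs)
  refine ⟨k, ?_⟩
  rw [Matrix.mulVec_smul, hk, hg, tensorPower_single, smul_smul, mul_inv_cancel₀ hs, one_smul]
  rfl

/-- The column `b.col 0` and the row `e₂` do not depend on `i`; this is the source of the common
eigenvectors. -/
theorem tensor_fiducial (b : Matrix (Fin 3) (Fin 3) ℂ) (i : Fin 2) :
    tensor (fiducial b) i =
      vecMulVec (b.col 0) (Pi.single (![1, 0] i) 1) +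
        vecMulVec (b.col (![2, 1] i)) (Pi.single 2 1) := by
  ext α β
  fin_cases i <;> fin_cases β <;>
    simp [tensor, fiducial, LLT, ket, Matrix.mulVec_add, Matrix.kroneckerMap_apply,
      vecMulVec_apply, Matrix.one_apply]

/-- The `e₂` term of each `A^i` kills `b.col 0` because `b 2 0 = 0`. -/
theorem list_prod_mulVec_col (b : Matrix (Fin 3) (Fin 3) ℂ) (hb : b 2 0 = 0) (l : List (Fin 2)) :
    (l.map (tensor (fiducial b))).prod *ᵥ b.col 0 =
      (l.map ![b 1 0, b 0 0]).prod • b.col 0 := by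
  induction l with
  | nil => simp
  | cons i l ih =>
    have h : tensor (fiducial b) i *ᵥ b.col 0 = ![b 1 0, b 0 0] i • b.col 0 := by
      rw [tensor_fiducial]
      ext α
      fin_cases i <;> simp [Matrix.add_mulVec, vecMulVec_mulVec, hb, mul_comm]
    rw [List.map_cons, List.prod_cons, ← Matrix.mulVec_mulVec, ih, Matrix.mulVec_smul, h,
      List.map_cons, List.prod_cons, smul_smul, mul_comm]

theorem single_vecMul_list_prod (b : Matrix (Fin 3) (Fin 3) ℂ) (hb : b 2 0 = 0)
    (l : List (Fin 2)) :
    Pi.single 2 1 ᵥ* (l.map (tensor (fiducial b))).prod =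
      (l.map ![b 2 2, b 2 1]).prod • (Pi.single 2 1 : Fin 3 → ℂ) := by
  induction l with
  | nil => simp
  | cons i l ih =>
    have h : Pi.single 2 1 ᵥ* tensor (fiducial b) i =
        ![b 2 2, b 2 1] i • (Pi.single 2 1 : Fin 3 → ℂ) := by
      rw [tensor_fiducial]
      ext α
      fin_cases i <;> simp [Matrix.vecMul_add, vecMul_vecMulVec, hb]
    rw [List.map_cons, List.prod_cons, ← Matrix.vecMul_vecMul, h, Matrix.smul_vecMul, ih,
      List.map_cons, List.prod_cons, smul_smul]

/-- Split only the first factor into its two rank-one terms: by cyclicity the remaining product acts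
on `b.col 0` or on `e₂`, hence as a scalar. The empty product has trace 3, not 2. -/
theorem trace_list_prod (b : Matrix (Fin 3) (Fin 3) ℂ) (hb : b 2 0 = 0) {l : List (Fin 2)}
    (hl : l ≠ []) :
    (l.map (tensor (fiducial b))).prod.trace =
      (l.map ![b 2 2, b 2 1]).prod + (l.map ![b 1 0, b 0 0]).prod := by
  obtain ⟨i, l, rfl⟩ := List.exists_cons_of_ne_nil hl
  simp only [List.map_cons, List.prod_cons]
  rw [Matrix.trace_mul_comm, tensor_fiducial, Matrix.mul_add, Matrix.trace_add, Matrix.mul_vecMulVec,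
    list_prod_mulVec_col b hb, Matrix.trace_mul_comm, Matrix.vecMulVec_mul,
    single_vecMul_list_prod b hb, Matrix.trace_vecMulVec, Matrix.trace_vecMulVec]
  fin_cases i <;> simp <;> ring

theorem mps_fiducial (b : Matrix (Fin 3) (Fin 3) ℂ) (hb : b 2 0 = 0) {N : ℕ} (hN : 1 ≤ N) :
    mps (fiducial b) N = tensorPower N ![b 2 2, b 2 1] + tensorPower N ![b 1 0, b 0 0] := by
  ext j
  have hl : List.ofFn j ≠ [] := by
    rw [Ne, List.ofFn_eq_nil_iff]
    exact Nat.one_le_iff_ne_zero.mp hN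
  have h := trace_list_prod b hb hl
  simp only [List.map_ofFn, List.prod_ofFn, Function.comp_apply] at h
  exact h

end QubitMPS

/-- Here `hammingNorm j` is the number `|j|` of entries of `j` equal to `1`. -/
theorem mainTheorem5 (b : Matrix (Fin 3) (Fin 3) ℂ) (hb : b 2 0 = 0) (N : ℕ) (hN : 1 ≤ N) :
    (∀ j : Fin N → Fin 2,
      (QubitMPS.tensorProd (QubitMPS.fiducial b) j).trace =
        b 2 2 ^ (N - hammingNorm j) * b 2 1 ^ hammingNorm j +
          b 0 0 ^ hammingNorm j * b 1 0 ^ (N - hammingNorm j)) ∧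
    QubitMPS.PermutationInvariant (QubitMPS.mps (QubitMPS.fiducial b) N) ∧
    (QubitMPS.mps (QubitMPS.fiducial b) N ≠ 0 →
      QubitMPS.SLOCCEquiv (QubitMPS.mps (QubitMPS.fiducial b) N) (QubitMPS.zeroState N) ∨
      QubitMPS.SLOCCEquiv (QubitMPS.mps (QubitMPS.fiducial b) N) (QubitMPS.ghzState N) ∨
      QubitMPS.OnlyGlobalSymmetries (QubitMPS.mps (QubitMPS.fiducial b) N)) := by
  have hmps := QubitMPS.mps_fiducial b hb hN
  refine ⟨fun j => ?_, fun σ j => ?_, fun hne => ?_⟩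
  · have h := congrFun hmps j
    rw [Pi.add_apply, QubitMPS.tensorPower_apply, QubitMPS.tensorPower_apply] at h
    exact h.trans (congrArg _ (mul_comm _ _))
  · rw [hmps, Pi.add_apply, Pi.add_apply, QubitMPS.tensorPower_comp_perm,
      QubitMPS.tensorPower_comp_perm]
  · rw [hmps] at hne ⊢
    by_cases h : ![b 2 2, b 2 1] 0 * ![b 1 0, b 0 0] 1 = ![b 1 0, b 0 0] 0 * ![b 2 2, b 2 1] 1
    · exact Or.inl (QubitMPS.sloccEquiv_zeroState hN h hne)
    · exact Or.inr (Or.inl (QubitMPS.sloccEquiv_ghzState hN h))
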